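/- **Setting.** There are $N$ products. Quantities, prices, revenues and expenditure are in logs, and log quantities range over $\mathbb R$. Let $Z$ be the set of values of an observed demand shifter, and let demand shocks take values in $[0,1]$. An HSA demand system is a pair $(\mathfrak s^*,q)$ of a log budget-share function $\mathfrak s^*:\mathbb R\times Z\times[0,1]\to\mathbb R$ and a quantity index $q(\mathbf y,\mathbf z,\mathbf u)$ such that, for all $\mathbf y\in\mathbb R^N$, $\mathbf z\in Z^N$, $\mathbf u\in[0,1]^N$, $$\sum_{i=1}^N \exp\big(\mathfrak s^*(y_i-q(\mathbf y,\mathbf z,\mathbf u),z_i,u_i)\big)=1 .$$ At log expenditure $\Phi$ its log inverse demand is $p_i=\Phi+\mathfrak s^*(y_i-q(\mathbf y,\mathbf z,\mathbf u),z_i,u_i)-y_i$. Observed log revenues $r_1,\dots,r_N$ come from this system at a baseline state $(\mathbf y^0,\mathbf z^0,\mathbf u^0)$: $\ln\big(e^{r_i}/\sum_j e^{r_j}\big)=\mathfrak s^*(y^0_i-q(\mathbf y^0,\mathbf z^0,\mathbf u^0),z^0_i,u^0_i)$ for all $i$, with the normalization $q(\mathbf y^0,\mathbf z^0,\mathbf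 u^0)=0$. Put $\Phi_0=\ln\sum_j e^{r_j}$. Firms take $q(\mathbf y^0,\mathbf z^0,\mathbf u^0)$ and $\Phi_0$ as given, so the reduced-form revenue function is $\varphi(y,z,u)=\Phi_0+\mathfrak s^*(y-q(\mathbf y^0,\mathbf z^0,\mathbf u^0),z,u)$. Assume that for all $(z,u)$ revenue $y\mapsto\varphi(y,z,u)$ is strictly increasing and inverse demand $y\mapsto\varphi(y,z,u)-y$ is strictly decreasing. The function $\varphi$ is known up to the location of $\varphi^{-1}(\cdot,z,u)$: the known revenue function $\hat\varphi$ has, for every $(z,u)$, the same range as $\varphi$ and satisfies $\hat\varphi^{-1}(r,z,u)=a+\varphi^{-1}(r,z,u)$ there, for some $a\in\mathbb R$ not depending on $(r,z,u)$. Put $\hat{\mathfrak s}=\hat\varphi-\Phi_0$, and let $\Delta\hat q$ solve $$\sum_{i=1}^N\exp\big(\hat{\mathfrak s}(y_i-\Delta\hat q(\mathbf y,\mathbf z,\mathbf u),z_i,u_i)\big)=1\quad\text{for all }(\mathbf y,\mathbf z,\mathbf u).$$ (For $a=0$ these are $\mathfrak s=\varphi-\Phi_0$ and $\Delta q=q-q(\mathbf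 y^0,\mathbf z^0,\mathbf u^0)$.) A preference is a binary relation $\succsim$ on $\mathbb R^N$ (log consumption vectors). It is *rational* if complete and transitive; *monotone* if $y_i>x_i$ for all $i$ implies $\mathbf y\succ\mathbf x$; *convex* if, for each $\mathbf x$, the set of quantity vectors $(e^{y_1},\dots,e^{y_N})$ with $\mathbf y\succsim\mathbf x$ is convex; *continuous* if all upper and lower contour sets are closed; *homothetic* if $\mathbf x\succsim\mathbf y$ implies $\mathbf x+c\mathbf 1\succsim\mathbf y+c\mathbf 1$ for all $c\in\mathbb R$. It *generates* a demand system at $(\mathbf z,\mathbf u)$ if, for all log prices $\mathbf p$, log expenditures $\Phi$ and $\mathbf y$, the vector $\mathbf y$ is a $\succsim$-best element of $\{\mathbf x:\sum_i e^{p_i+x_i}\le e^{\Phi}\}$ if and only if $\mathbf p$ is the log inverse demand of the system at $(\Phi,\mathbf y,\mathbf z,\mathbf u)$. **Claim.** For every $a$ and $\hat\varphi$ as above, $\Delta\hat q$ exists and is unique. For every $(\mathbf z,\mathbf u)$: (a) There is a unique monotone, convex, continuous, homothetic rational preference $\succsim$ that generates the HSA demand system $(\mathfrak s^*,q)$ at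 $(\mathbf z,\mathbf u)$. (b) There is a rule, not depending on the industry, that computes from $(\hat{\mathfrak s},\Delta\hat q)$ and $(\mathbf z,\mathbf u)$ a vector $\mathbf b\in\mathbb R^N$ such that $$\ln U(\mathbf y)=\Delta\hat q(\mathbf y,\mathbf z,\mathbf u)+\sum_{i=1}^N\int_{b_i}^{y_i-\Delta\hat q(\mathbf y,\mathbf z,\mathbf u)}\exp\big(\hat{\mathfrak s}(\zeta,z_i,u_i)\big)\,d\zeta$$ represents $\succsim$, satisfies $\ln U(\mathbf y+c\mathbf 1)=\ln U(\mathbf y)+c$ for all $\mathbf y$ and $c$, and has $\ln U(\mathbf b)=0$. In particular this holds for $\hat{\mathfrak s}=\mathfrak s$, $\Delta\hat q=\Delta q$. (c) The demand system and the preference do not depend on the location normalization $a$: one has $\Delta\hat q=\Delta q-a$; the log inverse demand of $(\hat{\mathfrak s},\Delta\hat q)$ is the same function of $(\Phi,\mathbf y)$ as that of $(\mathfrak s^*,q)$, and measuring log quantities as $\mathbf y+a\mathbf 1$ changes the log prices to $\mathbf p-a\mathbf 1$; and the same $\succsim$ is the unique monotone, convex, continuous, homothetic rational preference that generates $(\hat{\mathfrak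 s},\Delta\hat q)$ at $(\mathbf z,\mathbf u)$. -/

import Mathlib

open scoped unitInterval

noncomputable section

namespace HSA

/-- Log budget-share functions: log (relative) output, observed demand shifter, demand shock. -/
abbrev ShareFn (Z : Type*) := ℝ → Z → I → ℝ

/-- Quantity indices: functions of the aggregate state `(y, z, u)`, with `y` the vector of log
quantities. -/
abbrev IndexFn (N : ℕ) (Z : Type*) := (Fin N → ℝ) → (Fin N → Z) → (Fin N → I) → ℝ

/-- The adding-up constraint on market shares, at every aggregate state. -/
def AddingUp {N : ℕ} {Z : Type*} (s : ShareFn Z) (q : IndexFn N Z) : Prop :=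
  ∀ y z u, ∑ i, Real.exp (s (y i - q y z u) (z i) (u i)) = 1

/-- The inverse demand system of `(s, q)`: the log price of product `i` when log expenditure is
`Φ` and the log quantities are `y`. -/
def logPrice {N : ℕ} {Z : Type*} (s : ShareFn Z) (q : IndexFn N Z) (z : Fin N → Z)
    (u : Fin N → I) (Φ : ℝ) (y : Fin N → ℝ) (i : Fin N) : ℝ :=
  Φ + s (y i - q y z u) (z i) (u i) - y i

/-- The log utility function built from a log budget-share function, a quantity index and
lower limits of integration `b`. -/
def logUtility {N : ℕ} {Z : Type*} (s : ShareFn Z) (q : IndexFn N Z) (b : Fin N → ℝ)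
    (z : Fin N → Z) (u : Fin N → I) (y : Fin N → ℝ) : ℝ :=
  q y z u + ∑ i, ∫ ζ in (b i)..(y i - q y z u), Real.exp (s ζ (z i) (u i))

/-- The inverse `φ⁻¹(r, z, u)` of a revenue function in its first argument; it is meaningful for
`r` in the range of `φ(·, z, u)`. -/
def revInv {Z : Type*} (φ : ShareFn Z) (r : ℝ) (z : Z) (u : I) : ℝ :=
  Function.invFun (fun y => φ y z u) r

/-- `φ'` is `φ` under another location normalization: `φ'⁻¹ = a + φ⁻¹`. -/
def IsLocationShift {Z : Type*} (a : ℝ) (φ φ' : ShareFn Z) : Prop :=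
  ∀ z u, Set.range (fun y => φ' y z u) = Set.range (fun y => φ y z u) ∧
    ∀ r ∈ Set.range (fun y => φ y z u), revInv φ' r z u = a + revInv φ r z u

/-- A monotone, convex, continuous and homothetic rational preference over strictly positive
consumption bundles, written in logs: `R y x` says that the bundle with log quantities `y` is at
least as good as the one with log quantities `x`. Convexity is convexity of the upper contour
sets in quantities; scaling a bundle by `exp c` adds `c` to all log quantities. -/
structure IsRegularPreference {N : ℕ} (R : (Fin N → ℝ) → (Fin N → ℝ) → Prop) : Prop where
  complete : ∀ x y, R x y ∨ R y x
  transitive : ∀ x y w, R x y → R y w → R x w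
  monotone : ∀ x y, (∀ i, x i < y i) → R y x ∧ ¬ R x y
  convex : ∀ x, Convex ℝ ((fun (y : Fin N → ℝ) (i : Fin N) => Real.exp (y i)) '' {y | R y x})
  closed_upper : ∀ x, IsClosed {y | R y x}
  closed_lower : ∀ x, IsClosed {y | R x y}
  homothetic : ∀ x y (c : ℝ), R x y → R (fun i => x i + c) (fun i => y i + c)

/-- The budget set, in log quantities, at log prices `p` and log expenditure `Φ`. -/
def budget {N : ℕ} (p : Fin N → ℝ) (Φ : ℝ) : Set (Fin N → ℝ) :=
  {y | ∑ i, Real.exp (p i + y i) ≤ Real.exp Φ}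

/-- `y` is a best affordable bundle for `R` at log prices `p` and log expenditure `Φ`. -/
def IsDemanded {N : ℕ} (R : (Fin N → ℝ) → (Fin N → ℝ) → Prop) (p : Fin N → ℝ) (Φ : ℝ)
    (y : Fin N → ℝ) : Prop :=
  y ∈ budget p Φ ∧ ∀ x ∈ budget p Φ, R y x

/-- The preference `R` generates the demand system `(s, q)` at the demand shifters `(z, u)`:
its demand correspondence and the demand system have the same graph. -/
def Generates {N : ℕ} {Z : Type*} (R : (Fin N → ℝ) → (Fin N → ℝ) → Prop) (s : ShareFn Z)
    (q : IndexFn N Z) (z : Fin N → Z) (u : Fin N → I) : Prop :=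
  ∀ (p : Fin N → ℝ) (Φ : ℝ) (y : Fin N → ℝ),
    IsDemanded R p Φ y ↔ ∀ i, p i = logPrice s q z u Φ y i

/-- `V` represents `R`. -/
def Represents {N : ℕ} (V : (Fin N → ℝ) → ℝ) (R : (Fin N → ℝ) → (Fin N → ℝ) → Prop) : Prop :=
  ∀ x y, R x y ↔ V y ≤ V x

/-- An industry with `N` products under an HSA demand system, observed in equilibrium at a
baseline state. Only the ingredients of the HSA system and the observed revenues are data; the
reduced-form revenue function is derived from them below. -/
structure Industry (N : ℕ) (Z : Type*) where
  /-- structural log budget-share function -/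
  share : ShareFn Z
  /-- quantity index -/
  index : IndexFn N Z
  /-- baseline log outputs -/
  y₀ : Fin N → ℝ
  /-- baseline observed demand shifters -/
  z₀ : Fin N → Z
  /-- baseline demand shocks -/
  u₀ : Fin N → I
  /-- observed log revenues -/
  r : Fin N → ℝ

namespace Industry

variable {N : ℕ} {Z : Type*} (E : Industry N Z)

/-- Log aggregate expenditure at the baseline. -/
def Φ : ℝ := Real.log (∑ j, Real.exp (E.r j))

/-- Reduced-form log revenue function: expenditure and the quantity index, which firms take as
given, are held at the baseline. -/
def rev : ShareFn Z := fun y z u => E.Φ + E.share (y - E.index E.y₀ E.z₀ E.u₀) z u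

/-- Reduced-form log inverse demand function. -/
def invDemand : ShareFn Z := fun y z u => E.rev y z u - y

/-- Change of the quantity index relative to the baseline. -/
def indexChange : IndexFn N Z := fun y z u => E.index y z u - E.index E.y₀ E.z₀ E.u₀

/-- The maintained assumptions. -/
structure Assumptions : Prop where
  /-- the quantity index is determined by adding up of the market shares -/
  adding_up : AddingUp E.share E.index
  /-- the observed revenues are those of the HSA demand system at the baseline state -/
  baseline : ∀ i, Real.log (Real.exp (E.r i) / ∑ j, Real.exp (E.r j)) =
    E.share (E.y₀ i - E.index E.y₀ E.z₀ E.u₀) (E.z₀ i) (E.u₀ i)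
  /-- normalization of the quantity index -/
  normalized : E.index E.y₀ E.z₀ E.u₀ = 0
  /-- revenue is strictly increasing in output -/
  rev_strictMono : ∀ z u, StrictMono fun y => E.rev y z u
  /-- inverse demand is strictly decreasing in output -/
  invDemand_strictAnti : ∀ z u, StrictAnti fun y => E.invDemand y z u

end Industry

/-- The reduced-form log budget-share function obtained from a revenue function `φ` and log
aggregate expenditure `Φ`. -/
def reducedShare {Z : Type*} (φ : ShareFn Z) (Φ : ℝ) : ShareFn Z := fun y z u => φ y z u - Φ

end HSA

end

/-! Fix the demand shifters. Each log share `f i` is increasing and `f i t - t` is decreasing, so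
each `f i` is 1-Lipschitz and adding up pins down an index `Q` that is monotone and moves one for
one with a common shift of `y`.

Existence rests on one supergradient inequality, `utility_le_add_sum`. As a function of a free index
value `t`, the utility formula is convex with derivative one minus the sum of the shares, so `Q`
minimizes it. With `t` frozen at the index of another bundle, each integral is concave in the
quantity level, since its derivative there is the exponential of a decreasing function.
Monotonicity, convexity and the description of demand all follow.

Uniqueness rests on `sub_eq_sub`. A regular preference has a log utility `V` that shifts with common
shifts; if it generates the demand, `V x - V y` is at most the log cost of `x` at the relative
prices of `y`. The constructed utility obeys the same bound. Using the bound in both directions, the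
difference of the two utilities changes by at most a sum of products of increments of prices and
quantities, which is of smaller than first order along a segment. Hence the difference is constant,
although `V` is not known to be differentiable.

Changing the location replaces the argument of the shares by its translate by `a` and lowers the
index by `a`, so relative positions in the true shares are unaffected. -/

open scoped Topology

namespace HSA

variable {N : ℕ}

/-! ### Real-variable estimates -/

/-- A function of log bundles that is monotone and shifts with a common shift of all coordinates
is continuous. -/
theorem continuous_of_monotone_of_add_const {F : (Fin N → ℝ) → ℝ}
    (hmono : ∀ x y, (∀ i, x i ≤ y i) → F x ≤ F y)
    (hadd : ∀ y c, F (fun i => y i + c) = F y + c) : Continuous F := by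
  have hle : ∀ x y, F x ≤ F y + dist x y := by
    intro x y
    rw [← hadd]
    refine hmono _ _ fun i => ?_
    have h := (le_abs_self (x i - y i)).trans (dist_le_pi_dist x y i)
    linarith
  refine (LipschitzWith.of_le_add hle).continuous

/-- In each product one factor tends to zero and the other is of order `s - t`, so `g` has zero
derivative everywhere. Continuity of `A i` suffices, which matters because prices need not be
differentiable. -/
theorem const_of_abs_sub_le_sum {g : ℝ → ℝ} {A B : Fin N → ℝ → ℝ}
    (hA : ∀ i, Continuous (A i)) (hB : ∀ i, Differentiable ℝ (B i))
    (h : ∀ s t, |g s - g t| ≤ ∑ i, |A i s - A i t| * |B i s - B i t|) (s t : ℝ) :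
    g s = g t := by
  have hd : ∀ t, HasDerivAt g 0 t := by
    intro t
    rw [hasDerivAt_iff_isLittleO]
    have hsum : (fun s => ∑ i, |A i s - A i t| * |B i s - B i t|) =o[𝓝 t] fun s => s - t := by
      refine Asymptotics.IsLittleO.fun_sum fun i _ => ?_
      have h1 : (fun s => |A i s - A i t|) =o[𝓝 t] fun _ => (1 : ℝ) := by
        rw [Asymptotics.isLittleO_one_iff]
        have := ((hA i).sub (continuous_const (y := A i t))).abs.tendsto t
        simpa using this
      have h2 : (fun s => |B i s - B i t|) =O[𝓝 t] fun s => s - t :=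
        ((hB i t).isBigO_sub).norm_left
      simpa using h1.mul_isBigO h2
    refine Asymptotics.IsBigO.trans_isLittleO (Asymptotics.IsBigO.of_bound 1 ?_) hsum
    refine Filter.Eventually.of_forall fun s => ?_
    have h0 : 0 ≤ ∑ i, |A i s - A i t| * |B i s - B i t| :=
      Finset.sum_nonneg fun i _ => by positivity
    simpa [abs_of_nonneg h0] using h s t
  exact is_const_of_deriv_eq_zero (fun t => (hd t).differentiableAt) (fun t => (hd t).deriv) s t

theorem mul_sub_le_integral_of_monotone {h : ℝ → ℝ} (hc : Continuous h) (hm : Monotone h)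
    (a b : ℝ) : h a * (b - a) ≤ ∫ ζ in a..b, h ζ := by
  rcases le_total a b with hab | hab
  · have := intervalIntegral.integral_mono_on (μ := MeasureTheory.volume) (f := fun _ => h a)
      (g := h) hab (by simp) (hc.intervalIntegrable _ _) fun x hx => hm hx.1
    simp only [intervalIntegral.integral_const, smul_eq_mul] at this
    linarith
  · have := intervalIntegral.integral_mono_on (μ := MeasureTheory.volume) (g := fun _ => h a)
      (f := h) hab (hc.intervalIntegrable _ _) (by simp) fun x hx => hm hx.2
    simp only [intervalIntegral.integral_const, smul_eq_mul] at this
    rw [intervalIntegral.integral_symm]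
    linarith

/-- Tangent inequality in levels for the integral of `exp ∘ g`, when `g ζ - ζ` decreases. -/
theorem integral_exp_le_of_antitone {g : ℝ → ℝ} (hc : Continuous g)
    (ha : Antitone fun ζ => g ζ - ζ) (a b : ℝ) :
    ∫ ζ in a..b, Real.exp (g ζ) ≤ Real.exp (g a - a) * (Real.exp b - Real.exp a) := by
  have hcg : Continuous fun ζ => Real.exp (g ζ) := Real.continuous_exp.comp hc
  have hce : Continuous fun ζ => Real.exp (g a - a) * Real.exp ζ := by fun_prop
  have hint : ∀ a' b', ∫ ζ in a'..b', Real.exp (g a - a) * Real.exp ζ =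
      Real.exp (g a - a) * (Real.exp b' - Real.exp a') := fun a' b' => by
    rw [intervalIntegral.integral_const_mul, integral_exp]
  rcases le_total a b with hab | hab
  · rw [← hint]
    refine intervalIntegral.integral_mono_on hab (hcg.intervalIntegrable _ _)
      (hce.intervalIntegrable _ _) fun x hx => ?_
    rw [← Real.exp_add, Real.exp_le_exp]
    have := ha hx.1
    dsimp only at this
    linarith
  · have : ∫ ζ in b..a, Real.exp (g a - a) * Real.exp ζ ≤ ∫ ζ in b..a, Real.exp (g ζ) := by
      refine intervalIntegral.integral_mono_on hab (hce.intervalIntegrable _ _)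
        (hcg.intervalIntegrable _ _) fun x hx => ?_
      rw [← Real.exp_add, Real.exp_le_exp]
      have := ha hx.2
      dsimp only at this
      linarith
    rw [hint] at this
    rw [intervalIntegral.integral_symm]
    linarith

/-! ### Share systems and their index -/

/-- Log budget-share functions of the products, at fixed demand shifters, together with an index
that makes the shares add up. -/
structure IsShareSystem (f : Fin N → ℝ → ℝ) (Q : (Fin N → ℝ) → ℝ) : Prop where
  strictMono : ∀ i, StrictMono (f i)
  strictAnti : ∀ i, StrictAnti fun t => f i t - t
  sum_eq_one : ∀ y, ∑ i, Real.exp (f i (y i - Q y)) = 1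

/-- Log utility at fixed demand shifters. -/
noncomputable def systemUtility (f : Fin N → ℝ → ℝ) (Q : (Fin N → ℝ) → ℝ) (b y : Fin N → ℝ) : ℝ :=
  Q y + ∑ i, ∫ ζ in (b i)..(y i - Q y), Real.exp (f i ζ)

/-- Prices, as a fraction of expenditure, at which `y` is bought. -/
noncomputable def relPrice (f : Fin N → ℝ → ℝ) (Q : (Fin N → ℝ) → ℝ) (y : Fin N → ℝ) (i : Fin N) : ℝ :=
  Real.exp (f i (y i - Q y) - y i)

theorem relPrice_pos (f : Fin N → ℝ → ℝ) (Q : (Fin N → ℝ) → ℝ) (y : Fin N → ℝ) (i : Fin N) :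
    0 < relPrice f Q y i := Real.exp_pos _

namespace IsShareSystem

variable {f : Fin N → ℝ → ℝ} {Q : (Fin N → ℝ) → ℝ}

theorem nonempty (hS : IsShareSystem f Q) : Nonempty (Fin N) := by
  by_contra h
  rw [not_nonempty_iff] at h
  simpa using hS.sum_eq_one 0

theorem continuous_share (hS : IsShareSystem f Q) (i : Fin N) : Continuous (f i) := by
  refine (LipschitzWith.of_le_add (f := f i) fun x y => ?_).continuous
  rcases le_total x y with h | h
  · have := (hS.strictMono i).monotone h
    have := dist_nonneg (x := x) (y := y)
    linarith
  · have h1 := (hS.strictAnti i).antitone h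
    have h2 := le_abs_self (x - y)
    rw [← Real.dist_eq] at h2
    linarith

theorem sum_exp_lt (hS : IsShareSystem f Q) {a b : Fin N → ℝ} (h : ∀ i, a i < b i) :
    ∑ i, Real.exp (f i (a i)) < ∑ i, Real.exp (f i (b i)) := by
  have := hS.nonempty
  exact Finset.sum_lt_sum_of_nonempty Finset.univ_nonempty fun i _ =>
    Real.exp_lt_exp.2 (hS.strictMono i (h i))

theorem index_mono (hS : IsShareSystem f Q) {x y : Fin N → ℝ} (h : ∀ i, x i ≤ y i) : Q x ≤ Q y := by
  by_contra! hlt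
  have := hS.sum_exp_lt (a := fun i => x i - Q x) (b := fun i => y i - Q y)
    fun i => by linarith [h i]
  rw [hS.sum_eq_one, hS.sum_eq_one] at this
  exact lt_irrefl _ this

theorem index_unique (hS : IsShareSystem f Q) {y : Fin N → ℝ} {t : ℝ} (h : ∑ i, Real.exp (f i (y i - t)) = 1) :
    t = Q y := by
  rcases lt_trichotomy t (Q y) with hlt | heq | hlt
  · have := hS.sum_exp_lt (a := fun i => y i - Q y) (b := fun i => y i - t)
      fun i => by linarith
    rw [hS.sum_eq_one, h] at this
    exact absurd this (lt_irrefl _)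
  · exact heq
  · have := hS.sum_exp_lt (b := fun i => y i - Q y) (a := fun i => y i - t)
      fun i => by linarith
    rw [hS.sum_eq_one, h] at this
    exact absurd this (lt_irrefl _)

theorem index_add_const (hS : IsShareSystem f Q) (y : Fin N → ℝ) (c : ℝ) : Q (fun i => y i + c) = Q y + c := by
  symm
  apply hS.index_unique
  rw [← hS.sum_eq_one y]
  exact Finset.sum_congr rfl fun i _ => by ring_nf

theorem continuous_index (hS : IsShareSystem f Q) : Continuous Q :=
  continuous_of_monotone_of_add_const (fun _ _ => hS.index_mono) hS.index_add_const

theorem continuous_relPrice (hS : IsShareSystem f Q) (i : Fin N) : Continuous fun y => relPrice f Q y i := by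
  have h1 := hS.continuous_index
  have h2 := hS.continuous_share i
  unfold relPrice
  fun_prop

theorem sum_relPrice_mul_exp (hS : IsShareSystem f Q) (y : Fin N → ℝ) : ∑ i, relPrice f Q y i * Real.exp (y i) = 1 := by
  rw [← hS.sum_eq_one y]
  refine Finset.sum_congr rfl fun i _ => ?_
  rw [relPrice, ← Real.exp_add]
  ring_nf

/-! ### The utility function and its supergradient -/

theorem utility_add_const (hS : IsShareSystem f Q) (b y : Fin N → ℝ) (c : ℝ) :
    systemUtility f Q b (fun i => y i + c) = systemUtility f Q b y + c := by
  simp only [systemUtility, hS.index_add_const, add_sub_add_right_eq_sub]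
  ring

theorem integral_exp_sub (hS : IsShareSystem f Q) (i : Fin N) (a b c : ℝ) :
    (∫ ζ in a..c, Real.exp (f i ζ)) - ∫ ζ in a..b, Real.exp (f i ζ) =
      ∫ ζ in b..c, Real.exp (f i ζ) := by
  have hc : Continuous fun ζ => Real.exp (f i ζ) :=
    Real.continuous_exp.comp (hS.continuous_share i)
  exact intervalIntegral.integral_interval_sub_left (hc.intervalIntegrable _ _)
    (hc.intervalIntegrable _ _)

/-- The index minimizes the utility formula over all values of the index. -/
theorem utility_le (hS : IsShareSystem f Q) (b x : Fin N → ℝ) (t : ℝ) :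
    systemUtility f Q b x ≤ t + ∑ i, ∫ ζ in (b i)..(x i - t), Real.exp (f i ζ) := by
  -- The coefficients on the left are the market shares at `x`; they sum to one, so the left sides
  -- add up to `Q x - t`.
  have h : ∀ i, Real.exp (f i (x i - Q x)) * (Q x - t) ≤
      (∫ ζ in (b i)..(x i - t), Real.exp (f i ζ)) -
        ∫ ζ in (b i)..(x i - Q x), Real.exp (f i ζ) := fun i => by
    rw [hS.integral_exp_sub]
    have := mul_sub_le_integral_of_monotone (h := fun ζ => Real.exp (f i ζ))
      (Real.continuous_exp.comp (hS.continuous_share i))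
      (Real.exp_monotone.comp (hS.strictMono i).monotone) (x i - Q x) (x i - t)
    convert this using 2
    ring
  have := Finset.sum_le_sum fun i (_ : i ∈ Finset.univ) => h i
  rw [← Finset.sum_mul, hS.sum_eq_one, Finset.sum_sub_distrib] at this
  rw [systemUtility]
  linarith

/-- Log utility is concave in quantities, with the relative prices as supergradient. -/
theorem utility_le_add_sum (hS : IsShareSystem f Q) (b x y : Fin N → ℝ) :
    systemUtility f Q b x ≤ systemUtility f Q b y +
      ∑ i, relPrice f Q y i * (Real.exp (x i) - Real.exp (y i)) := by
  refine (hS.utility_le b x (Q y)).trans ?_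
  have h : ∀ i, (∫ ζ in (b i)..(x i - Q y), Real.exp (f i ζ)) -
        ∫ ζ in (b i)..(y i - Q y), Real.exp (f i ζ) ≤
      relPrice f Q y i * (Real.exp (x i) - Real.exp (y i)) := fun i => by
    rw [hS.integral_exp_sub]
    refine (integral_exp_le_of_antitone (hS.continuous_share i) (hS.strictAnti i).antitone
      _ _).trans_eq ?_
    rw [relPrice, mul_sub, mul_sub, ← Real.exp_add, ← Real.exp_add, ← Real.exp_add,
      ← Real.exp_add]
    ring_nf
  have := Finset.sum_le_sum fun i (_ : i ∈ Finset.univ) => h i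
  rw [Finset.sum_sub_distrib] at this
  rw [systemUtility]
  linarith

theorem utility_mono (hS : IsShareSystem f Q) (b : Fin N → ℝ) {x y : Fin N → ℝ} (h : ∀ i, x i ≤ y i) :
    systemUtility f Q b x ≤ systemUtility f Q b y := by
  refine (hS.utility_le_add_sum b x y).trans ?_
  have : ∑ i, relPrice f Q y i * (Real.exp (x i) - Real.exp (y i)) ≤ 0 :=
    Finset.sum_nonpos fun i _ => mul_nonpos_of_nonneg_of_nonpos (relPrice_pos f Q y i).le
      (sub_nonpos.2 (Real.exp_le_exp.2 (h i)))
  linarith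

theorem utility_lt (hS : IsShareSystem f Q) (b : Fin N → ℝ) {x y : Fin N → ℝ} (h : ∀ i, x i < y i) :
    systemUtility f Q b x < systemUtility f Q b y := by
  refine (hS.utility_le_add_sum b x y).trans_lt ?_
  have := hS.nonempty
  have : ∑ i, relPrice f Q y i * (Real.exp (x i) - Real.exp (y i)) < 0 :=
    Finset.sum_neg (fun i _ => mul_neg_of_pos_of_neg (relPrice_pos f Q y i)
      (sub_neg.2 (Real.exp_lt_exp.2 (h i)))) Finset.univ_nonempty
  linarith

theorem continuous_utility (hS : IsShareSystem f Q) (b : Fin N → ℝ) : Continuous (systemUtility f Q b) :=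
  continuous_of_monotone_of_add_const (fun _ _ => hS.utility_mono b) (hS.utility_add_const b)

/-- The supergradient inequality at the mixture `m` is averaged over both endpoints; the linear
terms cancel. -/
theorem convex_upper (hS : IsShareSystem f Q) (b : Fin N → ℝ) (r : ℝ) :
    Convex ℝ ((fun (y : Fin N → ℝ) (i : Fin N) => Real.exp (y i)) ''
      {y | r ≤ systemUtility f Q b y}) := by
  rintro _ ⟨x, hx, rfl⟩ _ ⟨y, hy, rfl⟩ α β hα hβ hαβ
  have hpos : ∀ i, 0 < α * Real.exp (x i) + β * Real.exp (y i) := fun i => by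
    rcases hα.eq_or_lt with h | h
    · have : β = 1 := by linarith
      rw [← h, this]
      simpa using Real.exp_pos _
    · exact add_pos_of_pos_of_nonneg (mul_pos h (Real.exp_pos _))
        (mul_nonneg hβ (Real.exp_pos _).le)
  set m : Fin N → ℝ := fun i => Real.log (α * Real.exp (x i) + β * Real.exp (y i)) with hm
  have hexp : ∀ i, Real.exp (m i) = α * Real.exp (x i) + β * Real.exp (y i) := fun i =>
    Real.exp_log (hpos i)
  refine ⟨m, ?_, ?_⟩
  · have h1 := mul_le_mul_of_nonneg_left (hx.trans (hS.utility_le_add_sum b x m)) hα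
    have h2 := mul_le_mul_of_nonneg_left (hy.trans (hS.utility_le_add_sum b y m)) hβ
    have h3 : α * ∑ i, relPrice f Q m i * (Real.exp (x i) - Real.exp (m i)) +
        β * ∑ i, relPrice f Q m i * (Real.exp (y i) - Real.exp (m i)) = 0 := by
      rw [Finset.mul_sum, Finset.mul_sum, ← Finset.sum_add_distrib]
      refine Finset.sum_eq_zero fun i _ => ?_
      rw [hexp]
      obtain rfl : β = 1 - α := by linarith
      ring
    obtain rfl : β = 1 - α := by linarith
    simp only [Set.mem_ofPred_eq]
    linarith
  · ext i
    simp [hexp]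

theorem isRegularPreference (hS : IsShareSystem f Q) (b : Fin N → ℝ) :
    IsRegularPreference fun x y => systemUtility f Q b y ≤ systemUtility f Q b x where
  complete x y := le_total _ _
  transitive _ _ _ h1 h2 := h2.trans h1
  monotone x y h := ⟨(hS.utility_lt b h).le, (hS.utility_lt b h).not_ge⟩
  convex x := hS.convex_upper b _
  closed_upper _ := isClosed_le continuous_const (hS.continuous_utility b)
  closed_lower _ := isClosed_le (hS.continuous_utility b) continuous_const
  homothetic x y c h := by
    rw [hS.utility_add_const, hS.utility_add_const]
    exact add_le_add_left h c

/-! ### Demand -/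

/-- A utility-maximizing bundle is supported by its relative prices only. -/
theorem relPrice_le_of_isDemanded (hS : IsShareSystem f Q) {b p y : Fin N → ℝ} {Φ : ℝ}
    (h : IsDemanded (fun x y => systemUtility f Q b y ≤ systemUtility f Q b x) p Φ y)
    (i : Fin N) : relPrice f Q y i ≤ Real.exp (p i - Φ) := by
  set w : ℝ := Real.exp (p i - Φ) with hw
  have hw0 : 0 < w := Real.exp_pos _
  -- The quantity `w⁻¹` of good `i` alone exhausts expenditure. Mixing it with `y` stays affordable,
  -- and the weight `1 - ε` keeps all quantities positive.
  let X : ℝ → Fin N → ℝ := fun ε k => (1 - ε) * Real.exp (y k) + ε * if k = i then w⁻¹ else 0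
  have hX0 : ∀ k, X 0 k = Real.exp (y k) := fun k => by simp [X]
  have hlim : Filter.Tendsto (fun ε k => Real.log (X ε k)) (𝓝[>] 0) (𝓝 y) := by
    refine Filter.Tendsto.mono_left ?_ nhdsWithin_le_nhds
    rw [tendsto_pi_nhds]
    intro k
    have hc : ContinuousAt (fun ε => Real.log (X ε k)) 0 := by
      refine ContinuousAt.log ?_ (by rw [hX0]; exact (Real.exp_pos _).ne')
      simp only [X]
      fun_prop
    have := hc.tendsto
    rwa [hX0, Real.log_exp] at this
  -- The supergradient is taken at the perturbed bundle, which is no better than `y`; dividing by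
  -- `ε` leaves an inequality that passes to the limit by continuity of relative prices.
  have hstep : ∀ᶠ ε in 𝓝[>] (0 : ℝ), relPrice f Q (fun k => Real.log (X ε k)) i * w⁻¹ ≤
      ∑ k, relPrice f Q (fun k => Real.log (X ε k)) k * Real.exp (y k) := by
    filter_upwards [Ioo_mem_nhdsGT (zero_lt_one (α := ℝ))] with ε hε
    have hpos : ∀ k, 0 < X ε k := fun k => by
      have h1 : 0 < (1 - ε) * Real.exp (y k) := mul_pos (by linarith [hε.2]) (Real.exp_pos _)
      have h2 : 0 ≤ ε * if k = i then w⁻¹ else 0 :=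
        mul_nonneg hε.1.le (by split_ifs <;> positivity)
      simp only [X]
      linarith
    set x : Fin N → ℝ := fun k => Real.log (X ε k) with hx
    have hexp : ∀ k, Real.exp (x k) = X ε k := fun k => Real.exp_log (hpos k)
    have hb : x ∈ budget p Φ := by
      have hy := h.1
      simp only [budget, Set.mem_ofPred_eq] at hy ⊢
      have hw' : Real.exp (p i) * w⁻¹ = Real.exp Φ := by
        rw [hw, ← Real.exp_neg, ← Real.exp_add]
        ring_nf
      have : ∑ k, Real.exp (p k + x k) =
          (1 - ε) * ∑ k, Real.exp (p k + y k) + ε * Real.exp Φ := by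
        simp only [Real.exp_add, hexp, X, mul_add, Finset.sum_add_distrib, Finset.mul_sum]
        congr 1
        · exact Finset.sum_congr rfl fun k _ => by ring
        · simp only [mul_ite, mul_zero, Finset.sum_ite_eq', Finset.mem_univ, if_true]
          rw [← hw']
          ring
      rw [this]
      have := mul_le_mul_of_nonneg_left hy (by linarith [hε.2] : 0 ≤ 1 - ε)
      linarith
    have h1 := h.2 x hb
    have h2 := hS.utility_le_add_sum b y x
    have h3 : ∑ k, relPrice f Q x k * (Real.exp (y k) - Real.exp (x k)) =
        ε * (∑ k, relPrice f Q x k * Real.exp (y k) - relPrice f Q x i * w⁻¹) := by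
      have : relPrice f Q x i * w⁻¹ = ∑ k, relPrice f Q x k * if k = i then w⁻¹ else 0 := by
        simp
      rw [this, ← Finset.sum_sub_distrib, Finset.mul_sum]
      refine Finset.sum_congr rfl fun k _ => ?_
      rw [hexp]
      simp only [X]
      ring
    have h4 : 0 ≤ ε * (∑ k, relPrice f Q x k * Real.exp (y k) - relPrice f Q x i * w⁻¹) := by
      rw [← h3]
      linarith
    linarith [nonneg_of_mul_nonneg_right h4 hε.1]
  have hP : ∀ k, Filter.Tendsto (fun ε => relPrice f Q (fun k => Real.log (X ε k)) k) (𝓝[>] 0)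
      (𝓝 (relPrice f Q y k)) := fun k => ((hS.continuous_relPrice k).tendsto y).comp hlim
  have := le_of_tendsto_of_tendsto ((hP i).mul_const w⁻¹)
    (tendsto_finsetSum Finset.univ fun k _ => (hP k).mul_const (Real.exp (y k))) hstep
  rw [hS.sum_relPrice_mul_exp] at this
  rwa [← div_eq_mul_inv, div_le_one hw0] at this

theorem isDemanded_iff (hS : IsShareSystem f Q) (b p : Fin N → ℝ) (Φ : ℝ) (y : Fin N → ℝ) :
    IsDemanded (fun x y => systemUtility f Q b y ≤ systemUtility f Q b x) p Φ y ↔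
      ∀ i, p i = Φ + f i (y i - Q y) - y i := by
  have hsum : ∀ x : Fin N → ℝ, ∑ i, Real.exp (p i + x i) =
      Real.exp Φ * ∑ i, Real.exp (p i - Φ) * Real.exp (x i) := fun x => by
    rw [Finset.mul_sum]
    refine Finset.sum_congr rfl fun i _ => ?_
    rw [← Real.exp_add, ← Real.exp_add]
    ring_nf
  have hbudget : ∀ x : Fin N → ℝ, x ∈ budget p Φ ↔
      ∑ i, Real.exp (p i - Φ) * Real.exp (x i) ≤ 1 := fun x => by
    simp only [budget, Set.mem_ofPred_eq, hsum]
    exact mul_le_iff_le_one_right (Real.exp_pos Φ)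
  constructor
  · intro h i
    have hle := hS.relPrice_le_of_isDemanded h
    have hy := (hbudget y).1 h.1
    rw [← hS.sum_relPrice_mul_exp y] at hy
    have hle' : ∀ k ∈ Finset.univ, relPrice f Q y k * Real.exp (y k) ≤
        Real.exp (p k - Φ) * Real.exp (y k) := fun k _ =>
      mul_le_mul_of_nonneg_right (hle k) (Real.exp_pos _).le
    -- Relative prices value `y` at one, and the actual prices are at least as high yet value it at
    -- no more than one, so every term is an equality.
    have heq := (Finset.sum_eq_sum_iff_of_le hle').1 ((Finset.sum_le_sum hle').antisymm hy) i
      (Finset.mem_univ i)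
    have := Real.exp_injective (mul_right_cancel₀ (Real.exp_pos _).ne' heq)
    linarith
  · intro h
    have hw : ∀ i, Real.exp (p i - Φ) = relPrice f Q y i := fun i => by
      rw [relPrice, h i]
      ring_nf
    simp only [hw] at hbudget
    refine ⟨(hbudget y).2 (hS.sum_relPrice_mul_exp y).le, fun x hx => ?_⟩
    refine (hS.utility_le_add_sum b x y).trans ?_
    have := (hbudget x).1 hx
    have hy := hS.sum_relPrice_mul_exp y
    simp only [mul_sub, Finset.sum_sub_distrib]
    linarith

end IsShareSystem

/-! ### Uniqueness of the preference -/

/-- A regular preference has a log utility that shifts with a common shift of all log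
quantities. -/
theorem IsRegularPreference.exists_represents {R : (Fin N → ℝ) → (Fin N → ℝ) → Prop}
    (hR : IsRegularPreference R) :
    ∃ V, Represents V R ∧ ∀ y c, V (fun i => y i + c) = V y + c := by
  have hconst : Continuous fun (c : ℝ) (_ : Fin N) => c := by fun_prop
  have hex : ∀ y : Fin N → ℝ, ∃ c : ℝ, R y (fun _ => c) ∧ R (fun _ => c) y := by
    intro y
    have hy : ∀ i, |y i| ≤ ‖y‖ := fun i => norm_le_pi_norm y i
    -- Completeness makes two closed sets cover the connected diagonal, and monotonicity makes both
    -- nonempty, so some constant bundle is indifferent to `y`.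
    have := isPreconnected_closed_iff.1 (isPreconnected_univ (α := ℝ))
      {c | R y fun _ => c} {c | R (fun _ => c) y}
      ((hR.closed_lower y).preimage hconst) ((hR.closed_upper y).preimage hconst)
      (fun c _ => hR.complete _ _)
      ⟨-‖y‖ - 1, trivial, (hR.monotone _ _ fun i => by linarith [neg_abs_le (y i), hy i]).1⟩
      ⟨‖y‖ + 1, trivial, (hR.monotone _ _ fun i => by linarith [le_abs_self (y i), hy i]).1⟩
    obtain ⟨c, -, h1, h2⟩ := this
    exact ⟨c, h1, h2⟩
  have hlt : ∀ c d : ℝ, R (fun _ => c) (fun _ => d) → d ≤ c := by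
    intro c d h
    by_contra! hcd
    exact (hR.monotone _ _ fun _ => hcd).2 h
  choose V hV1 hV2 using hex
  refine ⟨V, fun x y => ⟨fun h => ?_, fun h => ?_⟩, fun y c => ?_⟩
  · exact hlt _ _ (hR.transitive _ _ _ (hV2 x) (hR.transitive _ _ _ h (hV1 y)))
  · refine hR.transitive _ _ _ (hV1 x) (hR.transitive _ _ _ ?_ (hV2 y))
    rcases h.eq_or_lt with h | h
    · rw [h]
      exact (hR.complete _ _).elim id id
    · exact (hR.monotone _ _ fun _ => h).1
  · apply le_antisymm
    · exact hlt _ _ (hR.transitive _ _ _ (hR.homothetic _ _ c (hV2 y)) (hV1 _))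
    · exact hlt _ _ (hR.transitive _ _ _ (hV2 _) (hR.homothetic _ _ c (hV1 y)))

/-- Change of utility is bounded by the log cost of the new bundle at the old relative prices. -/
theorem sub_le_log_cost {f : Fin N → ℝ → ℝ} {Q : (Fin N → ℝ) → ℝ} [Nonempty (Fin N)]
    {R : (Fin N → ℝ) → (Fin N → ℝ) → Prop} {V : (Fin N → ℝ) → ℝ} (hV : Represents V R)
    (hadd : ∀ y c, V (fun i => y i + c) = V y + c)
    (hgen : ∀ p Φ y, (∀ i, p i = Φ + f i (y i - Q y) - y i) → IsDemanded R p Φ y)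
    (x y : Fin N → ℝ) :
    V x - V y ≤ Real.log (∑ i, relPrice f Q y i * Real.exp (x i)) := by
  have hpos : 0 < ∑ i, relPrice f Q y i * Real.exp (x i) :=
    Finset.sum_pos (fun i _ => mul_pos (relPrice_pos f Q y i) (Real.exp_pos _))
      Finset.univ_nonempty
  set c := Real.log (∑ i, relPrice f Q y i * Real.exp (x i)) with hc
  have hd := hgen (fun i => f i (y i - Q y) - y i) 0 y fun i => by ring
  -- Scaling `x` down by its cost makes it exactly affordable at the prices that support `y`.
  have hmem : (fun i => x i + -c) ∈ budget (fun i => f i (y i - Q y) - y i) 0 := by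
    simp only [budget, Set.mem_ofPred_eq, ← add_assoc]
    simp only [Real.exp_add _ (-c), ← Finset.sum_mul]
    rw [Real.exp_neg, Real.exp_zero, hc, Real.exp_log hpos]
    simp only [Real.exp_add]
    exact (mul_inv_cancel₀ hpos.ne').le
  have := (hV _ _).1 (hd.2 _ hmem)
  rw [hadd] at this
  linarith

/-- Two log utilities that generate the same demand differ by a constant. -/
theorem IsShareSystem.sub_eq_sub {f : Fin N → ℝ → ℝ} {Q : (Fin N → ℝ) → ℝ}
    (hS : IsShareSystem f Q) {V W : (Fin N → ℝ) → ℝ}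
    (hV : ∀ x y, V x - V y ≤ Real.log (∑ i, relPrice f Q y i * Real.exp (x i)))
    (hW : ∀ x y, W x - W y ≤ Real.log (∑ i, relPrice f Q y i * Real.exp (x i)))
    (x y : Fin N → ℝ) : V x - W x = V y - W y := by
  have := hS.nonempty
  have hlog : ∀ x y : Fin N → ℝ, Real.log (∑ i, relPrice f Q y i * Real.exp (x i)) ≤
      ∑ i, relPrice f Q y i * (Real.exp (x i) - Real.exp (y i)) := by
    intro x y
    have hpos : 0 < ∑ i, relPrice f Q y i * Real.exp (x i) :=
      Finset.sum_pos (fun i _ => mul_pos (relPrice_pos f Q y i) (Real.exp_pos _))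
        Finset.univ_nonempty
    simp only [mul_sub, Finset.sum_sub_distrib, hS.sum_relPrice_mul_exp]
    exact Real.log_le_sub_one_of_pos hpos
  have hone : ∀ x y : Fin N → ℝ, (V x - W x) - (V y - W y) ≤
      ∑ i, |relPrice f Q x i - relPrice f Q y i| * |Real.exp (x i) - Real.exp (y i)| := by
    intro x y
    have h1 := (hV x y).trans (hlog x y)
    have h2 := (hW y x).trans (hlog y x)
    have h3 : ∑ i, relPrice f Q y i * (Real.exp (x i) - Real.exp (y i)) +
        ∑ i, relPrice f Q x i * (Real.exp (y i) - Real.exp (x i)) ≤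
        ∑ i, |relPrice f Q x i - relPrice f Q y i| * |Real.exp (x i) - Real.exp (y i)| := by
      rw [← Finset.sum_add_distrib]
      refine Finset.sum_le_sum fun i _ => ?_
      rw [← abs_mul]
      refine le_trans (le_of_eq ?_) (neg_le_abs _)
      ring
    linarith
  let γ : ℝ → Fin N → ℝ := fun t i => y i + t * (x i - y i)
  have hγ : Continuous γ := by fun_prop
  have := const_of_abs_sub_le_sum (g := fun t => V (γ t) - W (γ t))
    (A := fun i t => relPrice f Q (γ t) i) (B := fun i t => Real.exp (γ t i))
    (fun i => (hS.continuous_relPrice i).comp hγ) (fun i => by simp only [γ]; fun_prop)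
    (fun s t => abs_sub_le_iff.2 ⟨hone _ _, (hone _ _).trans_eq
      (by simp only [abs_sub_comm (relPrice f Q (γ s) _), abs_sub_comm (Real.exp (γ s _))])⟩) 1 0
  simpa [γ] using this

theorem IsShareSystem.eq_of_isRegularPreference {f : Fin N → ℝ → ℝ} {Q : (Fin N → ℝ) → ℝ}
    (hS : IsShareSystem f Q) (b : Fin N → ℝ) {R : (Fin N → ℝ) → (Fin N → ℝ) → Prop}
    (hR : IsRegularPreference R)
    (hgen : ∀ p Φ y, (∀ i, p i = Φ + f i (y i - Q y) - y i) → IsDemanded R p Φ y) :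
    R = fun x y => systemUtility f Q b y ≤ systemUtility f Q b x := by
  have := hS.nonempty
  obtain ⟨V, hV, hadd⟩ := hR.exists_represents
  have hVc := sub_le_log_cost hV hadd hgen
  have hUc := sub_le_log_cost (f := f) (Q := Q) (V := systemUtility f Q b)
    (R := fun x y => systemUtility f Q b y ≤ systemUtility f Q b x)
    (fun _ _ => Iff.rfl) (hS.utility_add_const b) fun p Φ y => (hS.isDemanded_iff b p Φ y).2
  ext x y
  rw [hV x y]
  have := hS.sub_eq_sub hVc hUc x y
  constructor <;> intro h <;> linarith

/-! ### Change of location -/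

theorem IsLocationShift.apply_eq {Z : Type*} {a : ℝ} {φ φ' : ShareFn Z}
    (h : IsLocationShift a φ φ') (hφ : ∀ z u, StrictMono fun y => φ y z u) (y : ℝ) (z : Z)
    (u : unitInterval) : φ' y z u = φ (y - a) z u := by
  obtain ⟨hr, hinv⟩ := h z u
  have hmem : φ (y - a) z u ∈ Set.range fun y => φ y z u := ⟨y - a, rfl⟩
  have h1 := hinv _ hmem
  have h2 : revInv φ (φ (y - a) z u) z u = y - a :=
    Function.leftInverse_invFun (hφ z u).injective (y - a)
  have h3 : φ' (revInv φ' (φ (y - a) z u) z u) z u = φ (y - a) z u :=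
    Function.invFun_eq (f := fun y => φ' y z u) (hr.symm ▸ hmem : _ ∈ Set.range fun y => φ' y z u)
  rwa [h1, h2, add_sub_cancel] at h3

namespace Industry

variable {Z : Type*} {E : Industry N Z}

theorem Assumptions.isShareSystem (hE : E.Assumptions) (z : Fin N → Z)
    (u : Fin N → unitInterval) :
    IsShareSystem (fun i t => E.share t (z i) (u i)) (fun y => E.index y z u) where
  strictMono i s t h := by
    have := hE.rev_strictMono (z i) (u i) h
    simpa [rev, hE.normalized] using this
  strictAnti i s t h := by
    have := hE.invDemand_strictAnti (z i) (u i) h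
    simp only [invDemand, rev, hE.normalized, sub_zero] at this
    dsimp only
    linarith
  sum_eq_one y := hE.adding_up y z u

theorem Assumptions.reducedShare_eq (hE : E.Assumptions) {a : ℝ} {φ' : ShareFn Z}
    (h : IsLocationShift a E.rev φ') (t : ℝ) (z : Z) (u : unitInterval) :
    reducedShare φ' E.Φ t z u = E.share (t - a) z u := by
  simp [reducedShare, h.apply_eq hE.rev_strictMono, rev, hE.normalized]

theorem Assumptions.index_eq (hE : E.Assumptions) {a : ℝ} {φ' : ShareFn Z}
    (h : IsLocationShift a E.rev φ') {q : IndexFn N Z}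
    (hq : AddingUp (reducedShare φ' E.Φ) q) (y : Fin N → ℝ) (z : Fin N → Z)
    (u : Fin N → unitInterval) : q y z u = E.index y z u - a := by
  have := (hE.isShareSystem z u).index_unique (y := y) (t := q y z u + a) (by
    rw [← hq y z u]
    exact Finset.sum_congr rfl fun i _ => by rw [hE.reducedShare_eq h, sub_add_eq_sub_sub])
  linarith

theorem Assumptions.addingUp_reducedShare (hE : E.Assumptions) {a : ℝ} {φ' : ShareFn Z}
    (h : IsLocationShift a E.rev φ') :
    AddingUp (reducedShare φ' E.Φ) fun y z u => E.index y z u - a := fun y z u => by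
  rw [← hE.adding_up y z u]
  exact Finset.sum_congr rfl fun i _ => by rw [hE.reducedShare_eq h]; ring_nf

theorem Assumptions.logPrice_eq (hE : E.Assumptions) {a : ℝ} {φ' : ShareFn Z}
    (h : IsLocationShift a E.rev φ') {q : IndexFn N Z}
    (hq : AddingUp (reducedShare φ' E.Φ) q) (z : Fin N → Z) (u : Fin N → unitInterval) (Φ : ℝ)
    (y : Fin N → ℝ) (i : Fin N) :
    logPrice (reducedShare φ' E.Φ) q z u Φ y i = logPrice E.share E.index z u Φ y i := by
  rw [logPrice, logPrice, hE.reducedShare_eq h, hE.index_eq h hq]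
  ring_nf

theorem Assumptions.logUtility_eq (hE : E.Assumptions) {a : ℝ} {φ' : ShareFn Z}
    (h : IsLocationShift a E.rev φ') {q : IndexFn N Z}
    (hq : AddingUp (reducedShare φ' E.Φ) q) (z : Fin N → Z) (u : Fin N → unitInterval)
    (b y : Fin N → ℝ) :
    logUtility (reducedShare φ' E.Φ) q b z u y =
      systemUtility (fun i t => E.share t (z i) (u i)) (fun y => E.index y z u)
        (fun i => b i - a) y - a := by
  simp only [logUtility, systemUtility, hE.reducedShare_eq h, hE.index_eq h hq]
  have : ∀ i, ∫ ζ in (b i)..(y i - (E.index y z u - a)), Real.exp (E.share (ζ - a) (z i) (u i)) =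
      ∫ ζ in (b i - a)..(y i - E.index y z u), Real.exp (E.share ζ (z i) (u i)) := fun i => by
    rw [intervalIntegral.integral_comp_sub_right
      (fun ζ => Real.exp (E.share ζ (z i) (u i))) a]
    congr 1
    ring
  simp only [this]
  ring

end Industry

end HSA

open scoped unitInterval in
theorem mainTheorem5 (N : ℕ) (Z : Type*) :
    -- the rule `bId` that computes the constants from the known share function and index
    ∃ bId : HSA.ShareFn Z → HSA.IndexFn N Z → (Fin N → Z) → (Fin N → I) → (Fin N → ℝ),
    ∀ E : HSA.Industry N Z, E.Assumptions →
      -- under every location normalization the adding-up constraint determines the index change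
      (∀ (a : ℝ) (φ' : HSA.ShareFn Z), HSA.IsLocationShift a E.rev φ' →
        ∃! Δq' : HSA.IndexFn N Z, HSA.AddingUp (HSA.reducedShare φ' E.Φ) Δq') ∧
      ∀ (z : Fin N → Z) (u : Fin N → I),
        ∃ R : (Fin N → ℝ) → (Fin N → ℝ) → Prop,
          -- (a)
          (HSA.IsRegularPreference R ∧ HSA.Generates R E.share E.index z u ∧
            ∀ R', HSA.IsRegularPreference R' → HSA.Generates R' E.share E.index z u → R' = R) ∧
          ∀ (a : ℝ) (φ' : HSA.ShareFn Z) (Δq' : HSA.IndexFn N Z),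
            HSA.IsLocationShift a E.rev φ' →
            HSA.AddingUp (HSA.reducedShare φ' E.Φ) Δq' →
            ∀ s' : HSA.ShareFn Z, s' = HSA.reducedShare φ' E.Φ →
            ∀ b : Fin N → ℝ, b = bId s' Δq' z u →
              -- (b)
              (HSA.Represents (HSA.logUtility s' Δq' b z u) R ∧
                (∀ (y : Fin N → ℝ) (c : ℝ), HSA.logUtility s' Δq' b z u (fun i => y i + c) =
                  HSA.logUtility s' Δq' b z u y + c) ∧
                HSA.logUtility s' Δq' b z u b = 0) ∧
              -- (c)
              ((∀ y, Δq' y z u = E.indexChange y z u - a) ∧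
                (∀ Φ y i, HSA.logPrice s' Δq' z u Φ y i =
                  HSA.logPrice E.share E.index z u Φ y i) ∧
                (∀ Φ (y : Fin N → ℝ) i, HSA.logPrice s' Δq' z u Φ (fun j => y j + a) i =
                  HSA.logPrice E.share E.index z u Φ y i - a) ∧
                HSA.Generates R s' Δq' z u ∧
                ∀ R', HSA.IsRegularPreference R' → HSA.Generates R' s' Δq' z u → R' = R) := by
  -- Shifting the zero vector by minus its index gives a bundle of index zero, so at `b` every
  -- integral has equal limits and log utility vanishes.
  refine ⟨fun _ q z u _ => -q 0 z u, fun E hE => ⟨fun a φ' h => ?_, fun z u => ?_⟩⟩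
  · refine ⟨fun y z u => E.index y z u - a, hE.addingUp_reducedShare h, fun q hq => ?_⟩
    funext y z u
    exact hE.index_eq h hq y z u
  have hS := hE.isShareSystem z u
  set b₀ : Fin N → ℝ := fun _ => -E.index 0 z u with hb₀
  refine ⟨_, ⟨hS.isRegularPreference b₀, hS.isDemanded_iff b₀, fun R' hR' hgen =>
    hS.eq_of_isRegularPreference b₀ hR' fun p Φ y => (hgen p Φ y).2⟩, ?_⟩
  rintro a φ' q h hq s' rfl b rfl
  have hprice := hE.logPrice_eq h hq z u
  -- Moved back to the true location, the computed constants are the same for every `a`; the log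
  -- utilities then differ only by the constant `a` and represent one preference.
  have hb : (fun _ : Fin N => -q 0 z u - a) = b₀ := by
    funext i
    rw [hE.index_eq h hq, hb₀]
    ring
  have hU := hE.logUtility_eq h hq z u fun _ => -q 0 z u
  rw [hb] at hU
  have hindex := hS.index_add_const
  refine ⟨⟨fun x y => ?_, fun y c => ?_, ?_⟩, fun y => ?_, hprice, fun Φ y i => ?_, ?_, ?_⟩
  · rw [hU, hU]
    exact (sub_le_sub_iff_right a).symm
  · rw [hU, hU, hS.utility_add_const]
    ring
  · have h0 : q (fun _ => -q 0 z u) z u = 0 := by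
      have := hindex 0 (-q 0 z u)
      simp only [Pi.zero_apply, zero_add] at this
      rw [hE.index_eq h hq, this, hE.index_eq h hq]
      ring
    simp [HSA.logUtility, h0]
  · rw [hE.index_eq h hq, HSA.Industry.indexChange, hE.normalized, sub_zero]
  · rw [hprice, HSA.logPrice, HSA.logPrice, hindex, add_sub_add_right_eq_sub]
    ring
  · intro p Φ y
    simp only [hprice]
    exact hS.isDemanded_iff b₀ p Φ y
  · intro R' hR' hgen
    refine hS.eq_of_isRegularPreference b₀ hR' fun p Φ y hp => (hgen p Φ y).2 fun i => ?_
    rw [hprice]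
    exact hp i
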